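/- For a field $\mathbb{F}$ and a polynomial $P \in \mathbb{F}[x_1,\dots,x_n]$, the determinantal complexity of $P$ over $\mathbb{F}$ is the least $m \in \mathbb{N}$ for which there is an $m \times m$ matrix $M$, whose entries are polynomials in $\mathbb{F}[x_1,\dots,x_n]$ of degree at most one, such that $\det M = P$ (such an $m$ always exists). For every natural number $n \ge 6$, the determinantal complexity of $\sum_{i=1}^n x_i^n$ over $\mathbb{C}$ is at least $1.5n - 3$. The same holds over every algebraically closed field $\mathbb{F}$ of positive characteristic $p$: for every natural number $n \ge 6$ with $p \nmid n$, the determinantal complexity of $\sum_{i=1}^n x_i^n$ over $\mathbb{F}$ is at least $1.5n - 3$. -/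

import Mathlib

/-- `P` is the determinant of an `m × m` matrix whose entries are polynomials of degree at most
one. -/
def HasDetRep {σ F : Type*} [CommRing F] (P : MvPolynomial σ F) (m : ℕ) : Prop :=
  ∃ M : Matrix (Fin m) (Fin m) (MvPolynomial σ F),
    (∀ i j, (M i j).totalDegree ≤ 1) ∧ M.det = P

/-- Auxiliary form of a polynomial: `P = u A⁻¹ v` with affine entries and `A B = 1`, `det A = 1`. -/
theorem exists_affine_resolvent {σ F : Type*} [CommRing F] (P : MvPolynomial σ F) :
    ∃ (k : ℕ) (A B : Matrix (Fin k) (Fin k) (MvPolynomial σ F))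
      (u : Matrix (Fin 1) (Fin k) (MvPolynomial σ F))
      (v : Matrix (Fin k) (Fin 1) (MvPolynomial σ F)),
      (∀ i j, (A i j).totalDegree ≤ 1) ∧ (∀ i j, (u i j).totalDegree ≤ 1) ∧
      (∀ i j, (v i j).totalDegree ≤ 1) ∧ A * B = 1 ∧ A.det = 1 ∧
      u * B * v = Matrix.of fun _ _ => P := by
  induction P using MvPolynomial.induction_on with
  | C a =>
    refine ⟨1, 1, 1, 1, Matrix.of fun _ _ => MvPolynomial.C a, ?_, ?_, ?_, by simp, by simp,
      by simp⟩
    · intro i j; rw [Subsingleton.elim i j]; simp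
    · intro i j; rw [Subsingleton.elim i j]; simp
    · intro i j; simp
  | add p q hp hq =>
    obtain ⟨k, A, B, u, v, hA, hu, hv, hAB, hd, h⟩ := hp
    obtain ⟨l, A', B', u', v', hA', hu', hv', hAB', hd', h'⟩ := hq
    refine ⟨k + l,
      (Matrix.fromBlocks A 0 0 A').submatrix finSumFinEquiv.symm finSumFinEquiv.symm,
      (Matrix.fromBlocks B 0 0 B').submatrix finSumFinEquiv.symm finSumFinEquiv.symm,
      (Matrix.fromCols u u').submatrix id finSumFinEquiv.symm,
      (Matrix.fromRows v v').submatrix finSumFinEquiv.symm id, ?_, ?_, ?_, ?_, ?_, ?_⟩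
    · intro i j
      simp only [Matrix.submatrix_apply]
      rcases finSumFinEquiv.symm i with i | i <;> rcases finSumFinEquiv.symm j with j | j <;>
        simp [hA, hA']
    · intro i j
      simp only [Matrix.submatrix_apply]
      rcases finSumFinEquiv.symm j with j | j <;> simp [hu, hu']
    · intro i j
      simp only [Matrix.submatrix_apply]
      rcases finSumFinEquiv.symm i with i | i <;> simp [hv, hv']
    · rw [Matrix.submatrix_mul_equiv, Matrix.fromBlocks_multiply]
      simp [hAB, hAB']
    · rw [Matrix.det_submatrix_equiv_self, Matrix.det_fromBlocks_zero₂₁, hd, hd', one_mul]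
    · rw [Matrix.submatrix_mul_equiv, Matrix.submatrix_mul_equiv, Matrix.fromCols_mul_fromBlocks,
        Matrix.fromCols_mul_fromRows]
      simp only [Matrix.mul_zero, add_zero, zero_add, h, h']
      ext i j; simp
  | mul_X p s hp =>
    obtain ⟨k, A, B, u, v, hA, hu, hv, hAB, hd, h⟩ := hp
    refine ⟨k + 1,
      (Matrix.fromBlocks A (-v) 0 1).submatrix finSumFinEquiv.symm finSumFinEquiv.symm,
      (Matrix.fromBlocks B (B * v) 0 1).submatrix finSumFinEquiv.symm finSumFinEquiv.symm,
      (Matrix.fromCols u 0).submatrix id finSumFinEquiv.symm,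
      (Matrix.fromRows 0 (Matrix.of fun _ _ => MvPolynomial.X s)).submatrix
        finSumFinEquiv.symm id, ?_, ?_, ?_, ?_, ?_, ?_⟩
    · intro i j
      simp only [Matrix.submatrix_apply]
      rcases finSumFinEquiv.symm i with i | i <;> rcases finSumFinEquiv.symm j with j | j <;>
        simp [hA, hv, Subsingleton.elim _ (0 : Fin 1)]
    · intro i j
      simp only [Matrix.submatrix_apply]
      rcases finSumFinEquiv.symm j with j | j <;> simp [hu]
    · intro i j
      simp only [Matrix.submatrix_apply]
      rcases finSumFinEquiv.symm i with i | i
      · simp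
      · simpa [MvPolynomial.X] using
          MvPolynomial.totalDegree_monomial_le (Finsupp.single s 1) (1 : F)
    · rw [Matrix.submatrix_mul_equiv, Matrix.fromBlocks_multiply]
      simp [hAB, ← Matrix.mul_assoc]
    · rw [Matrix.det_submatrix_equiv_self, Matrix.det_fromBlocks_zero₂₁, hd]
      simp
    · rw [Matrix.submatrix_mul_equiv, Matrix.submatrix_mul_equiv, Matrix.fromCols_mul_fromBlocks,
        Matrix.fromCols_mul_fromRows]
      simp only [Matrix.mul_zero, Matrix.zero_mul, add_zero, zero_add, ← Matrix.mul_assoc, h]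
      ext i j; simp [Matrix.mul_apply]

/-- Every polynomial is the determinant of some square matrix of affine polynomials. -/
theorem exists_hasDetRep {σ F : Type*} [CommRing F] (P : MvPolynomial σ F) :
    ∃ m, HasDetRep P m := by
  obtain ⟨k, A, B, u, v, hA, hu, hv, hAB, hd, h⟩ := exists_affine_resolvent P
  refine ⟨k + 1,
    (Matrix.fromBlocks A v (-u) 0).submatrix finSumFinEquiv.symm finSumFinEquiv.symm, ?_, ?_⟩
  · intro i j
    simp only [Matrix.submatrix_apply]
    rcases finSumFinEquiv.symm i with i | i <;> rcases finSumFinEquiv.symm j with j | j <;>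
      simp [hA, hu, hv]
  · let hi : Invertible A := ⟨B, mul_eq_one_comm.mp hAB, hAB⟩
    have hB : ⅟A = B := rfl
    rw [Matrix.det_submatrix_equiv_self, Matrix.det_fromBlocks₁₁, hd, hB]
    simp [h]

open Classical in
/-- The determinantal complexity of a polynomial `P`: the least `m` such that `P` is the
determinant of an `m × m` matrix of polynomials of degree at most one. -/
noncomputable def detComplexity {σ F : Type*} [CommRing F] (P : MvPolynomial σ F) : ℕ :=
  Nat.find (exists_hasDetRep P)

/-!
Let `P = ∑ i, X i ^ d` and let `M` be an affine `m × m` matrix with determinant `P`.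

With at most four variables `deg P ≤ m` suffices. Otherwise the matrix `M 0` has rank `m - 1`.
Indeed, every minimal prime over the corank-one minors of a matrix has height at most `4`:
localizing at such a prime, an entry that becomes a unit is eliminated, which shrinks the matrix,
and if there is no such entry one adjoins a variable to one of them. If the rank of `M 0` were
smaller, then the origin would be an isolated point of the zero locus of these minors, because the
partial derivatives of `P` lie in the ideal they generate and vanish simultaneously only at the
origin.

Diagonalize `M 0`, choose an invertible block of size `d - 2` away from its null row and column
`o`, and let `Φ` be the Schur complement of that block, of size `m - d + 2`, multiplied by the
determinant of the block. Modulo row and column `o` of `Φ`, Jacobi's formula reads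
`δ ∂ᵢP = ψ ∂ᵢ(Φ o o)` with `δ` nonzero at the origin. Since `∂ᵢ(Φ o o)` has degree less than
`d - 1`, the further equation `ψ = c δ` leaves only finitely many points near the origin. Thus
`2 (m - d + 2)` equations isolate the origin, and Krull's height theorem bounds the number of
variables by `2 (m - d + 2)`.
-/

section UpdateRow

open Matrix

variable {l m n o α : Type*} [DecidableEq l] [DecidableEq n]

theorem updateRow_fromBlocks_inl (P : Matrix l m α) (Q : Matrix l o α) (R : Matrix n m α)
    (S : Matrix n o α) (i : l) (u : m → α) (v : o → α) :
    (fromBlocks P Q R S).updateRow (Sum.inl i) (Sum.elim u v) =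
      fromBlocks (P.updateRow i u) (Q.updateRow i v) R S := by
  ext (x | x) (y | y) <;> simp [updateRow_apply]

theorem updateRow_fromBlocks_inr (P : Matrix l m α) (Q : Matrix l o α) (R : Matrix n m α)
    (S : Matrix n o α) (i : n) (u : m → α) (v : o → α) :
    (fromBlocks P Q R S).updateRow (Sum.inr i) (Sum.elim u v) =
      fromBlocks P Q (R.updateRow i u) (S.updateRow i v) := by
  ext (x | x) (y | y) <;> simp [updateRow_apply]

end UpdateRow

section CorankOneMinors

open Matrix

variable {ι κ A B : Type*} [Fintype ι] [DecidableEq ι] [Fintype κ] [DecidableEq κ]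
  [CommRing A] [CommRing B]

/-- The ideal of corank-one minors of a square matrix, encoded through the adjugate. Its zero locus
is where the rank of the matrix drops by at least two. -/
def adjugateIdeal (M : Matrix ι ι A) : Ideal A :=
  Ideal.span (Set.range fun x : ι × ι => M.adjugate x.1 x.2)

theorem adjugate_mem_adjugateIdeal (M : Matrix ι ι A) (i j : ι) :
    M.adjugate i j ∈ adjugateIdeal M :=
  Ideal.subset_span ⟨(i, j), rfl⟩

theorem adjugateIdeal_le_iff {M : Matrix ι ι A} {I : Ideal A} :
    adjugateIdeal M ≤ I ↔ ∀ i j, M.adjugate i j ∈ I := by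
  rw [adjugateIdeal, Ideal.span_le, Set.range_subset_iff, Prod.forall]
  rfl

theorem adjugateIdeal_map (f : A →+* B) (M : Matrix ι ι A) :
    adjugateIdeal (M.map f) = (adjugateIdeal M).map f := by
  have hadj (x : ι × ι) : (M.map f).adjugate x.1 x.2 = f (M.adjugate x.1 x.2) :=
    (congrFun₂ (f.map_adjugate M) x.1 x.2).symm
  simp only [adjugateIdeal, Ideal.map_span, ← Set.range_comp, Function.comp_def, hadj]

theorem adjugateIdeal_mul_le_left (M N : Matrix ι ι A) :
    adjugateIdeal (M * N) ≤ adjugateIdeal M := by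
  rw [adjugateIdeal_le_iff]
  intro i j
  rw [adjugate_mul_distrib, mul_apply]
  exact Ideal.sum_mem _ fun k _ => Ideal.mul_mem_left _ _ (adjugate_mem_adjugateIdeal M k j)

theorem adjugateIdeal_mul_le_right (M N : Matrix ι ι A) :
    adjugateIdeal (M * N) ≤ adjugateIdeal N := by
  rw [adjugateIdeal_le_iff]
  intro i j
  rw [adjugate_mul_distrib, mul_apply]
  exact Ideal.sum_mem _ fun k _ => Ideal.mul_mem_right _ _ (adjugate_mem_adjugateIdeal N i k)

theorem adjugateIdeal_mul_of_isUnit (M : Matrix ι ι A) {N : Matrix ι ι A} (hN : IsUnit N) :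
    adjugateIdeal (M * N) = adjugateIdeal M := by
  obtain ⟨u, rfl⟩ := hN
  refine le_antisymm (adjugateIdeal_mul_le_left _ _) ?_
  simpa [Matrix.mul_assoc] using adjugateIdeal_mul_le_left (M * u.val) u⁻¹.val

theorem adjugateIdeal_mul_of_isUnit_left {M : Matrix ι ι A} (hM : IsUnit M) (N : Matrix ι ι A) :
    adjugateIdeal (M * N) = adjugateIdeal N := by
  obtain ⟨u, rfl⟩ := hM
  refine le_antisymm (adjugateIdeal_mul_le_right _ _) ?_
  simpa [← Matrix.mul_assoc] using adjugateIdeal_mul_le_right u⁻¹.val (u.val * N)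

theorem adjugateIdeal_submatrix_le (M : Matrix ι ι A) (e f : κ ≃ ι) :
    adjugateIdeal (M.submatrix e f) ≤ adjugateIdeal M := by
  have hperm : M.submatrix e f =
      (M * (1 : Matrix ι ι A).submatrix id (e.symm.trans f)).submatrix e e := by
    ext i j
    simp [Matrix.mul_apply, Matrix.one_apply]
  rw [hperm, adjugateIdeal_le_iff]
  intro i j
  rw [adjugate_submatrix_equiv_self, submatrix_apply]
  exact adjugateIdeal_mul_le_left _ _ (adjugate_mem_adjugateIdeal _ _ _)

theorem adjugateIdeal_submatrix (M : Matrix ι ι A) (e f : κ ≃ ι) :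
    adjugateIdeal (M.submatrix e f) = adjugateIdeal M := by
  refine le_antisymm (adjugateIdeal_submatrix_le M e f) ?_
  simpa using adjugateIdeal_submatrix_le (M.submatrix e f) e.symm f.symm

theorem det_mem_adjugateIdeal [Nonempty ι] (M : Matrix ι ι A) : M.det ∈ adjugateIdeal M := by
  obtain ⟨i⟩ := ‹Nonempty ι›
  rw [det_eq_sum_mul_adjugate_row M i]
  exact Ideal.sum_mem _ fun k _ => Ideal.mul_mem_left _ _ (adjugate_mem_adjugateIdeal _ _ _)

theorem adjugate_fromBlocks_zero_zero (P : Matrix ι ι A) (S : Matrix κ κ A) :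
    (fromBlocks P 0 0 S).adjugate = fromBlocks (S.det • P.adjugate) 0 0 (P.det • S.adjugate) := by
  have single_inl (i : ι) : (Pi.single (Sum.inl i) 1 : ι ⊕ κ → A) = Sum.elim (Pi.single i 1) 0 := by
    simp
  have single_inr (i : κ) : (Pi.single (Sum.inr i) 1 : ι ⊕ κ → A) =
      Sum.elim (0 : ι → A) (Pi.single i 1) := by
    simp
  ext (i | i) (j | j)
  · rw [adjugate_apply, single_inl, updateRow_fromBlocks_inl, det_fromBlocks_zero₂₁]
    simp [adjugate_apply, mul_comm]
  · rw [adjugate_apply, single_inl, updateRow_fromBlocks_inr, det_fromBlocks_zero₁₂]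
    rw [det_eq_zero_of_row_eq_zero (A := S.updateRow j 0) j (by simp)]
    simp
  · rw [adjugate_apply, single_inr, updateRow_fromBlocks_inl, det_fromBlocks_zero₂₁,
      det_eq_zero_of_row_eq_zero (A := P.updateRow j 0) j (by simp)]
    simp
  · rw [adjugate_apply, single_inr, updateRow_fromBlocks_inr, det_fromBlocks_zero₁₂]
    simp [adjugate_apply]

theorem adjugateIdeal_fromBlocks_zero_zero [Nonempty κ] {P : Matrix ι ι A} (hP : IsUnit P.det)
    (S : Matrix κ κ A) : adjugateIdeal (fromBlocks P 0 0 S) = adjugateIdeal S := by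
  refine le_antisymm ?_ ?_ <;> rw [adjugateIdeal_le_iff]
  · have hS : S.det ∈ adjugateIdeal S := det_mem_adjugateIdeal S
    rintro (i | i) (j | j) <;> rw [adjugate_fromBlocks_zero_zero]
    · exact Ideal.mul_mem_right _ _ hS
    · exact zero_mem _
    · exact zero_mem _
    · exact Ideal.mul_mem_left _ _ (adjugate_mem_adjugateIdeal S i j)
  · intro i j
    rw [← Ideal.unit_mul_mem_iff_mem _ hP]
    simpa [adjugate_fromBlocks_zero_zero] using
      adjugate_mem_adjugateIdeal (fromBlocks P 0 0 S) (Sum.inr i) (Sum.inr j)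

theorem adjugateIdeal_fromBlocks_of_invertible [Nonempty κ] (P : Matrix ι ι A) (Q : Matrix ι κ A)
    (R : Matrix κ ι A) (S : Matrix κ κ A) [Invertible P] :
    adjugateIdeal (fromBlocks P Q R S) = adjugateIdeal (S - R * ⅟P * Q) := by
  have hP : IsUnit P.det := (isUnit_iff_isUnit_det P).1 (isUnit_of_invertible P)
  rw [fromBlocks_eq_of_invertible₁₁, adjugateIdeal_mul_of_isUnit,
    adjugateIdeal_mul_of_isUnit_left, adjugateIdeal_fromBlocks_zero_zero hP]
  all_goals simp [isUnit_iff_isUnit_det]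

theorem exists_adjugateIdeal_eq_of_isUnit {k : ℕ} [NeZero k]
    (M : Matrix (Fin (k + 1)) (Fin (k + 1)) A) {i j : Fin (k + 1)} (h : IsUnit (M i j)) :
    ∃ N : Matrix (Fin k) (Fin k) A, adjugateIdeal M = adjugateIdeal N := by
  let e (i : Fin (k + 1)) : Unit ⊕ Fin k ≃ Fin (k + 1) :=
    (Equiv.sumComm _ _).trans ((Equiv.optionEquivSumPUnit _).symm.trans (finSuccEquiv' i).symm)
  have he (i : Fin (k + 1)) : e i (Sum.inl ()) = i := by simp [e]
  let M' := M.submatrix (e i) (e j)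
  have hpivot : IsUnit M'.toBlocks₁₁.det := by
    simpa [det_unique, toBlocks₁₁, M', he] using h
  let _ : Invertible M'.toBlocks₁₁ := M'.toBlocks₁₁.invertibleOfIsUnitDet hpivot
  refine ⟨M'.toBlocks₂₂ - M'.toBlocks₂₁ * ⅟M'.toBlocks₁₁ * M'.toBlocks₁₂, ?_⟩
  rw [← adjugateIdeal_fromBlocks_of_invertible, fromBlocks_toBlocks, adjugateIdeal_submatrix]

end CorankOneMinors

section PolynomialExtension

open Polynomial

variable {A : Type*} [CommRing A]

theorem map_C_le_comap_constantCoeff (p : Ideal A) :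
    p.map (C : A →+* A[X]) ≤ p.comap constantCoeff := by
  rw [Ideal.map_le_iff_le_comap]
  intro a ha
  simpa using ha

theorem comap_constantCoeff_mem_minimalPrimes {J : Ideal A[X]} {p : Ideal A}
    (hp : p ∈ (J.map constantCoeff).minimalPrimes) :
    p.comap constantCoeff ∈ (J ⊔ Ideal.span {X}).minimalPrimes := by
  have hsurj : Function.Surjective (constantCoeff : A[X] →+* A) := fun a => ⟨C a, by simp⟩
  have hcomap : J ⊔ Ideal.span {X} = (J.map constantCoeff).comap constantCoeff := by
    rw [Ideal.comap_map_of_surjective _ hsurj, ← RingHom.ker_eq_comap_bot, ker_constantCoeff]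
  rw [hcomap, Ideal.comap_minimalPrimes_eq_of_surjective hsurj]
  exact ⟨p, hp, rfl⟩

theorem map_C_lt_comap_constantCoeff (p : Ideal A) (hp : p ≠ ⊤) :
    p.map (C : A →+* A[X]) < p.comap constantCoeff := by
  refine (map_C_le_comap_constantCoeff p).lt_of_not_ge fun hle => hp ?_
  have hX : (X : A[X]) ∈ p.map C := hle (by simp)
  rw [Ideal.mem_map_C_iff] at hX
  exact (Ideal.eq_top_iff_one _).2 (by simpa using hX 1)

end PolynomialExtension

theorem eq_of_le_of_lt_of_mem_minimalPrimes_sup_span_singleton {A : Type*} [CommRing A]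
    [IsNoetherianRing A] {q p₁ p₂ : Ideal A} {x : A} [q.IsPrime] [p₁.IsPrime] (hle : q ≤ p₁)
    (hlt : p₁ < p₂) (hp₂ : p₂ ∈ (q ⊔ Ideal.span {x}).minimalPrimes) : q = p₁ := by
  by_contra hne
  have hheight := Ideal.map_height_le_one_of_mem_minimalPrimes hp₂
  have : p₂.IsPrime := hp₂.1.1
  let π := Ideal.Quotient.mk q
  have : (p₁.map π).IsPrime := Ideal.isPrime_map_quotientMk_of_isPrime hle
  have : (p₂.map π).IsPrime := Ideal.isPrime_map_quotientMk_of_isPrime (hle.trans hlt.le)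
  have hbot : ⊥ < p₁.map π := by
    rw [bot_lt_iff_ne_bot, Ne, Ideal.map_eq_bot_iff_le_ker, Ideal.mk_ker]
    exact fun h => hne (hle.antisymm h)
  have hmap : p₁.map π < p₂.map π := by
    refine (Ideal.map_mono hlt.le).lt_of_not_ge fun h => hlt.not_ge ?_
    rw [Ideal.map_le_iff_le_comap, Ideal.comap_map_quotientMk, sup_of_le_right hle] at h
    exact h
  have hheight₁ := Ideal.height_add_one_le_of_lt_of_isPrime hbot
  have hheight₂ := Ideal.height_add_one_le_of_lt_of_isPrime hmap
  exact absurd ((add_le_add_left (le_add_self.trans hheight₁) 1).trans (hheight₂.trans hheight))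
    (by decide)

open Polynomial in
theorem map_C_mem_minimalPrimes {A : Type*} [CommRing A] [IsNoetherianRing A] {J : Ideal A[X]}
    {p : Ideal A} (hp : p ∈ (J.map constantCoeff).minimalPrimes) (hJ : J ≤ p.map C) :
    p.map C ∈ J.minimalPrimes := by
  have hprime : p.IsPrime := hp.1.1
  have : (p.map (C : A →+* A[X])).IsPrime := Ideal.isPrime_map_C_of_isPrime
  refine ⟨⟨this, hJ⟩, fun q ⟨hq, hJq⟩ hqp => ?_⟩
  have hlt := map_C_lt_comap_constantCoeff p hprime.ne_top
  have hmin : p.comap constantCoeff ∈ (q ⊔ Ideal.span {X}).minimalPrimes := by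
    have hmin' := comap_constantCoeff_mem_minimalPrimes hp
    refine ⟨⟨hmin'.1.1, sup_le (hqp.trans hlt.le) (le_sup_right.trans hmin'.1.2)⟩, ?_⟩
    exact fun r ⟨hr, hqr⟩ hrp => hmin'.2 ⟨hr, (sup_le_sup_right hJq _).trans hqr⟩ hrp
  exact (eq_of_le_of_lt_of_mem_minimalPrimes_sup_span_singleton hqp hlt hmin).ge

open Polynomial in
theorem height_map_C_of_isPrime {A : Type*} [CommRing A] [IsNoetherianRing A] (p : Ideal A)
    [p.IsPrime] : (p.map (C : A →+* A[X])).height = p.height := by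
  have : (p.map (C : A →+* A[X])).IsPrime := Ideal.isPrime_map_C_of_isPrime
  have : (p.map (C : A →+* A[X])).LiesOver p := ⟨by
    ext a
    rw [Ideal.under, Ideal.mem_comap, Polynomial.algebraMap_eq, Ideal.mem_map_C_iff]
    exact ⟨fun ha n => by rw [coeff_C]; split_ifs <;> simp [ha], fun ha => by simpa using ha 0⟩⟩
  rw [Ideal.height_eq_height_add_of_liesOver_of_hasGoingDown p]
  rw [Polynomial.algebraMap_eq, Ideal.map_quotient_self]
  simp

universe u

section CorankOneMinors

open Matrix

open Polynomial in
theorem map_C_mem_minimalPrimes_adjugateIdeal {ι A : Type*} [Fintype ι] [DecidableEq ι]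
    [CommRing A] [IsNoetherianRing A] (hι : 2 < Fintype.card ι) (M : Matrix ι ι A) {p : Ideal A}
    (hp : p ∈ (adjugateIdeal M).minimalPrimes) (hM : ∀ i j, M i j ∈ p) (o : ι) :
    p.map C ∈ (adjugateIdeal (M.map C + single o o X)).minimalPrimes := by
  set N := M.map (C : A →+* A[X]) + single o o X with hN
  have hconst : N.map constantCoeff = M := by
    ext i j
    simp only [hN, map_apply, Matrix.add_apply, single_apply, map_add]
    split_ifs <;> simp
  refine map_C_mem_minimalPrimes ?_ ?_
  · rwa [← adjugateIdeal_map, hconst]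
  · rw [adjugateIdeal_le_iff]
    intro i j
    obtain ⟨r, hr⟩ : ∃ r, r ∉ ({o, j} : Finset ι) := by
      by_contra! h
      have := Finset.card_le_two (a := o) (b := j)
      rw [Finset.eq_univ_of_forall h, Finset.card_univ] at this
      omega
    obtain ⟨hro, hrj⟩ : r ≠ o ∧ r ≠ j := by simpa using hr
    rw [adjugate_apply, det_eq_sum_mul_adjugate_row _ r]
    refine Ideal.sum_mem _ fun l _ => Ideal.mul_mem_right _ _ ?_
    rw [updateRow_ne hrj]
    simpa [hN, single_apply, hro.symm] using Ideal.mem_map_of_mem C (hM r l)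

theorem height_le_card_of_mem_minimalPrimes_span_range {ι A : Type*} [Fintype ι] [CommRing A]
    [IsNoetherianRing A] (g : ι → A) {p : Ideal A}
    (hp : p ∈ (Ideal.span (Set.range g)).minimalPrimes) : p.height ≤ Fintype.card ι := by
  refine (Ideal.height_le_card_of_mem_minimalPrimes_span (Set.finite_range g) hp).trans ?_
  have hcard := Set.ncard_image_le (f := g) Set.finite_univ
  rw [Set.image_univ, Set.ncard_univ, Nat.card_eq_fintype_card] at hcard
  exact_mod_cast hcard

theorem height_le_of_mem_minimalPrimes_adjugateIdeal_of_notMem {k c : ℕ} [NeZero k]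
    {A : Type u} [CommRing A] [IsNoetherianRing A]
    (ih : ∀ {B : Type u} [CommRing B] [IsNoetherianRing B] (N : Matrix (Fin k) (Fin k) B)
      {q : Ideal B}, q ∈ (adjugateIdeal N).minimalPrimes → q.height ≤ c)
    (M : Matrix (Fin (k + 1)) (Fin (k + 1)) A) {p : Ideal A}
    (hp : p ∈ (adjugateIdeal M).minimalPrimes) {i j : Fin (k + 1)} (hij : M i j ∉ p) :
    p.height ≤ c := by
  have : p.IsPrime := hp.1.1
  let φ := algebraMap A (Localization.AtPrime p)
  obtain ⟨N, hN⟩ := exists_adjugateIdeal_eq_of_isUnit (M.map φ) (i := i) (j := j)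
    ((IsLocalization.AtPrime.isUnit_to_map_iff (Localization.AtPrime p) p (M i j)).2 hij)
  rw [← IsLocalization.AtPrime.under_maximalIdeal (Localization.AtPrime p) p,
    IsLocalization.height_under p.primeCompl]
  refine ih N ?_
  rw [← hN, adjugateIdeal_map, IsLocalization.minimalPrimes_map p.primeCompl, Set.mem_preimage,
    IsLocalization.AtPrime.under_maximalIdeal _ p]
  exact hp

theorem height_le_four_of_mem_minimalPrimes_adjugateIdeal (k : ℕ) :
    ∀ {A : Type*} [CommRing A] [IsNoetherianRing A] (M : Matrix (Fin k) (Fin k) A) {p : Ideal A},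
      p ∈ (adjugateIdeal M).minimalPrimes → p.height ≤ 4 := by
  induction k with
  | zero =>
    intro A _ _ M p hp
    exact (height_le_card_of_mem_minimalPrimes_span_range _ hp).trans (by simp)
  | succ k ih =>
    intro A _ _ M p hp
    have : p.IsPrime := hp.1.1
    obtain hk | hk := Nat.lt_or_ge k 2
    · refine (height_le_card_of_mem_minimalPrimes_span_range _ hp).trans ?_
      rw [Fintype.card_prod, Fintype.card_fin]
      have hcard : (k + 1) * (k + 1) ≤ 4 := by nlinarith
      exact_mod_cast hcard
    · have : NeZero k := ⟨by omega⟩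
      by_cases hM : ∀ i j, M i j ∈ p
      · rw [← height_map_C_of_isPrime]
        refine height_le_of_mem_minimalPrimes_adjugateIdeal_of_notMem ih _
          (map_C_mem_minimalPrimes_adjugateIdeal (by simpa using hk) M hp hM 0)
          (i := 0) (j := 0) fun h => ?_
        exact ‹p.IsPrime›.one_notMem (by simpa using Ideal.mem_map_C_iff.1 h 1)
      · push Not at hM
        obtain ⟨i, j, hij⟩ := hM
        exact height_le_of_mem_minimalPrimes_adjugateIdeal_of_notMem ih M hp hij

end CorankOneMinors

section Jacobi

open Matrix

variable {R A ι : Type*} [CommRing R] [CommRing A] [Algebra R A]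

theorem derivation_prod [DecidableEq ι] (d : Derivation R A A) (s : Finset ι) (f : ι → A) :
    d (∏ i ∈ s, f i) = ∑ i ∈ s, (∏ j ∈ s.erase i, f j) * d (f i) := by
  induction s using Finset.induction_on with
  | empty => simp
  | insert a s ha ih =>
    have herase {i : ι} (hi : i ∈ s) :
        ∏ j ∈ (insert a s).erase i, f j = f a * ∏ j ∈ s.erase i, f j := by
      rw [Finset.erase_insert_of_ne (by rintro rfl; exact ha hi),
        Finset.prod_insert (fun h => ha (Finset.mem_of_mem_erase h))]
    rw [Finset.prod_insert ha, d.leibniz, ih, Finset.sum_insert ha, Finset.erase_insert ha,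
      add_comm, Finset.sum_congr rfl fun i hi => congrArg (· * d (f i)) (herase hi)]
    simp only [smul_eq_mul, Finset.mul_sum, mul_assoc]

variable [Fintype ι] [DecidableEq ι]

theorem derivation_det (d : Derivation R A A) (M : Matrix ι ι A) :
    d M.det = ∑ i, ∑ k, M.adjugate i k * d (M k i) := by
  have hcol (i : ι) : ∑ k, M.adjugate i k * d (M k i) =
      (M.updateCol i fun k => d (M k i)).det := by
    rw [← cramer_apply, cramer_eq_adjugate_mulVec]
    rfl
  simp_rw [hcol, det_apply, map_sum]
  rw [Finset.sum_comm]
  refine Finset.sum_congr rfl fun τ _ => ?_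
  rw [← Finset.smul_sum, Units.smul_def, map_zsmul, ← Units.smul_def, derivation_prod]
  congr 1
  refine Finset.sum_congr rfl fun i _ => ?_
  rw [← Finset.mul_prod_erase _ _ (Finset.mem_univ i), updateCol_self, mul_comm]
  congr 1
  refine Finset.prod_congr rfl fun j hj => ?_
  rw [updateCol_ne (Finset.ne_of_mem_erase hj)]

theorem derivation_det_mem_adjugateIdeal (d : Derivation R A A) (M : Matrix ι ι A) :
    d M.det ∈ adjugateIdeal M := by
  rw [derivation_det]
  exact Ideal.sum_mem _ fun i _ => Ideal.sum_mem _ fun k _ =>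
    Ideal.mul_mem_right _ _ (adjugate_mem_adjugateIdeal M i k)

theorem det_mem_of_row_mem {I : Ideal A} {M : Matrix ι ι A} {o : ι} (hrow : ∀ j, M o j ∈ I) :
    M.det ∈ I := by
  rw [det_eq_sum_mul_adjugate_row M o]
  exact I.sum_mem fun j _ => I.mul_mem_right _ (hrow j)

theorem adjugate_mem_of_row_mem {I : Ideal A} {M : Matrix ι ι A} {o : ι}
    (hrow : ∀ j, M o j ∈ I) {i j : ι} (hj : j ≠ o) : M.adjugate i j ∈ I := by
  rw [adjugate_apply]
  refine det_mem_of_row_mem (o := o) fun k => ?_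
  rw [updateRow_ne hj.symm]
  exact hrow k

theorem adjugate_mem_of_col_mem {I : Ideal A} {M : Matrix ι ι A} {o : ι}
    (hcol : ∀ i, M i o ∈ I) {i j : ι} (hi : i ≠ o) : M.adjugate i j ∈ I := by
  rw [← transpose_apply M.adjugate, adjugate_transpose]
  exact adjugate_mem_of_row_mem (M := Mᵀ) hcol hi

theorem derivation_det_sub_mem (d : Derivation R A A) {I : Ideal A} {M : Matrix ι ι A} {o : ι}
    (hrow : ∀ j, M o j ∈ I) (hcol : ∀ i, M i o ∈ I) :
    d M.det - M.adjugate o o * d (M o o) ∈ I := by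
  rw [derivation_det, ← Finset.add_sum_erase _ _ (Finset.mem_univ o),
    ← Finset.add_sum_erase _ _ (Finset.mem_univ o), add_assoc, add_sub_cancel_left]
  refine I.add_mem (I.sum_mem fun k hk => I.mul_mem_right _ ?_)
    (I.sum_mem fun i hi => I.sum_mem fun k _ => I.mul_mem_right _ ?_)
  · exact adjugate_mem_of_row_mem hrow (Finset.ne_of_mem_erase hk)
  · exact adjugate_mem_of_col_mem hcol (Finset.ne_of_mem_erase hi)

end Jacobi

section PolynomialRing

open MvPolynomial

theorem mem_idealOfVars_iff {σ R : Type*} [CommRing R] {f : MvPolynomial σ R} :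
    f ∈ idealOfVars σ R ↔ constantCoeff f = 0 := by
  rw [← pow_one (idealOfVars σ R), mem_pow_idealOfVars_iff']
  simp [Finsupp.degree_eq_zero_iff, constantCoeff_eq]

theorem idealOfVars_eq_ker_constantCoeff (σ R : Type*) [CommRing R] :
    idealOfVars σ R = RingHom.ker (constantCoeff : MvPolynomial σ R →+* R) :=
  Ideal.ext fun _ => mem_idealOfVars_iff

theorem isPrime_idealOfVars (σ R : Type*) [CommRing R] [IsDomain R] :
    (idealOfVars σ R).IsPrime := by
  rw [idealOfVars_eq_ker_constantCoeff]
  exact RingHom.ker_isPrime _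

theorem card_le_height_ker_aeval_piecewise {σ R : Type*} [DecidableEq σ] [CommRing R] [IsDomain R]
    (s : Finset σ) :
    s.card ≤ (RingHom.ker
      (aeval (s.piecewise 0 X) : MvPolynomial σ R →ₐ[R] MvPolynomial σ R)).height := by
  induction s using Finset.induction_on with
  | empty => simp
  | insert a s ha ih =>
    let φ (s : Finset σ) : MvPolynomial σ R →ₐ[R] MvPolynomial σ R := aeval (s.piecewise 0 X)
    have hprime (s : Finset σ) : (RingHom.ker (φ s)).IsPrime := RingHom.ker_isPrime _
    have hcomp : (φ (insert a s)).comp (φ s) = φ (insert a s) := by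
      ext1 i
      by_cases hi : i ∈ s <;> simp [φ, hi]
    have hlt : RingHom.ker (φ s) < RingHom.ker (φ (insert a s)) := by
      refine lt_of_le_not_ge (fun f hf => ?_) fun hle => ?_
      · rw [RingHom.mem_ker] at hf ⊢
        rw [← hcomp, AlgHom.comp_apply, hf, map_zero]
      · have hX : X a ∈ RingHom.ker (φ s) := hle (by simp [φ, RingHom.mem_ker])
        simp [φ, RingHom.mem_ker, ha] at hX
    rw [Finset.card_insert_of_notMem ha, Nat.cast_add, Nat.cast_one]
    exact (add_le_add_left ih 1).trans (Ideal.height_add_one_le_of_lt_of_isPrime hlt)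

theorem card_le_height_idealOfVars (σ R : Type*) [Fintype σ] [CommRing R] [IsDomain R] :
    Fintype.card σ ≤ (idealOfVars σ R).height := by
  classical
  refine (card_le_height_ker_aeval_piecewise (R := R) Finset.univ).trans
    (Ideal.height_mono fun f hf => ?_)
  rw [RingHom.mem_ker, Finset.piecewise_univ, aeval_zero] at hf
  exact mem_idealOfVars_iff.2 (by simpa using hf)

theorem totalDegree_pderiv_le {σ R : Type*} [CommSemiring R] (i : σ) (p : MvPolynomial σ R) :
    (pderiv i p).totalDegree ≤ p.totalDegree - 1 := by
  refine Finset.sup_le fun m hm => ?_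
  rw [mem_support_iff, coeff_pderiv] at hm
  have hle := le_totalDegree (mem_support_iff.2 (left_ne_zero_of_mul hm))
  have hsum : ((m + Finsupp.single i 1).sum fun _ e => e) = (m.sum fun _ e => e) + 1 := by
    rw [Finsupp.sum_add_index' (by simp) (by simp), Finsupp.sum_single_index rfl]
  omega

theorem mem_restrictDegree_sup_of_X_pow_sub_mem {σ R : Type*} [CommRing R] {e : ℕ}
    {J : Ideal (MvPolynomial σ R)} (r : σ → MvPolynomial σ R)
    (hr : ∀ i, (r i).totalDegree < e) (hJ : ∀ i, X i ^ e - r i ∈ J) (f : MvPolynomial σ R) :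
    f ∈ restrictDegree σ R (e - 1) ⊔ J.restrictScalars R := by
  induction hN : f.totalDegree using Nat.strong_induction_on generalizing f with
  | _ N ih =>
  rw [f.as_sum]
  refine Submodule.sum_mem _ fun a ha => ?_
  by_cases hae : ∀ i, a i ≤ e - 1
  · refine Submodule.mem_sup_left ((mem_restrictDegree _ _ _).2 fun b hb i => ?_)
    rw [Finset.mem_singleton.1 (support_monomial_subset hb)]
    exact hae i
  · push Not at hae
    obtain ⟨i, hi⟩ := hae
    obtain ⟨b, rfl⟩ := exists_add_of_le (show Finsupp.single i e ≤ a by simpa using by omega)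
    set c := coeff (Finsupp.single i e + b) f
    have hsplit : monomial (Finsupp.single i e + b) c =
        monomial b c * r i + monomial b c * (X i ^ e - r i) := by
      rw [X_pow_eq_monomial, ← mul_add, add_sub_cancel, monomial_mul, mul_one, add_comm b]
    have hlt : (monomial b c * r i).totalDegree < N := by
      have ha' := le_totalDegree ha
      rw [Finsupp.sum_add_index' (by simp) (by simp), Finsupp.sum_single_index rfl] at ha'
      have hb : (monomial b c).totalDegree ≤ b.sum fun _ k => k := totalDegree_monomial_le b c
      have hri := hr i
      have hmul := totalDegree_mul (monomial b c) (r i)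
      omega
    rw [hsplit]
    exact Submodule.add_mem _ (ih _ hlt _ rfl) (Submodule.mem_sup_right (J.mul_mem_left _ (hJ i)))

theorem finite_quotient_of_X_pow_sub_mem {σ R : Type*} [Finite σ] [CommRing R] {e : ℕ}
    {J : Ideal (MvPolynomial σ R)} (r : σ → MvPolynomial σ R)
    (hr : ∀ i, (r i).totalDegree < e) (hJ : ∀ i, X i ^ e - r i ∈ J) :
    Module.Finite R (MvPolynomial σ R ⧸ J) := by
  refine Module.Finite.of_surjective
    ((Ideal.Quotient.mkₐ R J).toLinearMap.comp (restrictDegree σ R (e - 1)).subtype) fun x => ?_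
  obtain ⟨f, rfl⟩ := Ideal.Quotient.mk_surjective x
  obtain ⟨g, hg, h, hh, rfl⟩ :=
    Submodule.mem_sup.1 (mem_restrictDegree_sup_of_X_pow_sub_mem r hr hJ f)
  have hzero : Ideal.Quotient.mk J h = 0 := Ideal.Quotient.eq_zero_iff_mem.2 hh
  exact ⟨⟨g, hg⟩, by simp [hzero]⟩

theorem isMaximal_of_X_pow_sub_mem {σ F : Type*} [Finite σ] [Field F] {e : ℕ}
    {q : Ideal (MvPolynomial σ F)} [q.IsPrime] (r : σ → MvPolynomial σ F)
    (hr : ∀ i, (r i).totalDegree < e) (hq : ∀ i, X i ^ e - r i ∈ q) : q.IsMaximal := by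
  have := finite_quotient_of_X_pow_sub_mem r hr hq
  exact Ideal.Quotient.maximal_of_isField _
    (isField_of_isIntegral_of_isField' (Field.toIsField F))

theorem eq_idealOfVars_of_mul_X_pow_sub_mem {σ F : Type*} [Finite σ] [Field F] {e : ℕ}
    {q : Ideal (MvPolynomial σ F)} [q.IsPrime] (hq : q ≤ idealOfVars σ F)
    {δ ψ : MvPolynomial σ F} {c : F} (hδ : δ ∉ idealOfVars σ F) (hψ : ψ - C c * δ ∈ q)
    (r : σ → MvPolynomial σ F) (hr : ∀ i, (r i).totalDegree < e)
    (hX : ∀ i, δ * X i ^ e - ψ * r i ∈ q) : q = idealOfVars σ F := by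
  have hmax : q.IsMaximal := by
    refine isMaximal_of_X_pow_sub_mem (e := e) (fun i => C c * r i)
      (fun i => (totalDegree_mul _ _).trans_lt (by simpa using hr i)) fun i => ?_
    have hmul : δ * (X i ^ e - C c * r i) ∈ q := by
      convert q.add_mem (hX i) (q.mul_mem_right (r i) hψ) using 1
      ring
    exact (‹q.IsPrime›.mem_or_mem hmul).resolve_left fun h => hδ (hq h)
  exact hmax.eq_of_le (isPrime_idealOfVars σ F).ne_top hq

end PolynomialRing

section Degree

open Matrix MvPolynomial

variable {ι σ R : Type*} [Fintype ι] [CommRing R]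

theorem totalDegree_map_C_mul_mul_map_C_le (G H : Matrix ι ι R)
    {M : Matrix ι ι (MvPolynomial σ R)} {N : ℕ} (hM : ∀ i j, (M i j).totalDegree ≤ N) (i j : ι) :
    ((G.map C * M * H.map C : Matrix ι ι (MvPolynomial σ R)) i j).totalDegree ≤ N := by
  rw [mul_apply]
  refine totalDegree_finsetSum_le fun k _ => (totalDegree_mul _ _).trans ?_
  rw [map_apply, totalDegree_C, add_zero, mul_apply]
  refine totalDegree_finsetSum_le fun l _ => (totalDegree_mul _ _).trans ?_
  rw [map_apply, totalDegree_C, zero_add]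
  exact hM _ _

variable [DecidableEq ι]

theorem totalDegree_det_le (M : Matrix ι ι (MvPolynomial σ R)) (w : ι → ℕ)
    (hM : ∀ i j, (M i j).totalDegree ≤ w i) : M.det.totalDegree ≤ ∑ i, w i := by
  rw [det_apply]
  refine totalDegree_finsetSum_le fun τ _ => ?_
  have hprod : (∏ i, M (τ i) i).totalDegree ≤ ∑ i, w i := by
    refine (totalDegree_finsetProd _ _).trans ?_
    rw [← Equiv.sum_comp τ w]
    exact Finset.sum_le_sum fun i _ => hM _ _
  rcases Int.units_eq_one_or (Equiv.Perm.sign τ) with hs | hs <;> simpa [hs] using hprod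

theorem totalDegree_adjugate_le (M : Matrix ι ι (MvPolynomial σ R))
    (hM : ∀ i j, (M i j).totalDegree ≤ 1) (i j : ι) :
    (M.adjugate i j).totalDegree ≤ Fintype.card ι - 1 := by
  rw [adjugate_apply]
  refine (totalDegree_det_le _ (fun k => if k = j then 0 else 1) fun k l => ?_).trans ?_
  · obtain rfl | hk := eq_or_ne k j
    · rw [updateRow_self, Pi.single_apply]
      split_ifs <;> simp
    · simpa [hk] using hM k l
  · simp [Finset.sum_ite, Finset.filter_ne', Finset.card_erase_of_mem]

end Degree

section Schur

open Matrix

variable {α κ A : Type*} [Fintype κ] [DecidableEq κ] [CommRing A]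

/-- The Schur complement of the lower right block with its denominator cleared, that is, multiplied
by the determinant of that block. Unlike the Schur complement, it makes sense when the block is not
invertible. -/
def schurNumerator (M : Matrix (α ⊕ κ) (α ⊕ κ) A) : Matrix α α A :=
  M.toBlocks₂₂.det • M.toBlocks₁₁ - M.toBlocks₁₂ * M.toBlocks₂₂.adjugate * M.toBlocks₂₁

theorem det_schurNumerator_mul [Fintype α] [DecidableEq α] (M : Matrix (α ⊕ κ) (α ⊕ κ) A) :
    (schurNumerator M).det * M.toBlocks₂₂.det = M.det * M.toBlocks₂₂.det ^ Fintype.card α := by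
  have helim : M * fromBlocks (M.toBlocks₂₂.det • 1) 0 (-(M.toBlocks₂₂.adjugate * M.toBlocks₂₁)) 1 =
      fromBlocks (schurNumerator M) M.toBlocks₁₂ 0 M.toBlocks₂₂ := by
    conv_lhs => rw [← fromBlocks_toBlocks M]
    rw [fromBlocks_multiply]
    congr 1
    · simp [schurNumerator, sub_eq_add_neg, Matrix.mul_assoc]
    · simp
    · simp [← Matrix.mul_assoc, mul_adjugate]
    · simp
  rw [← det_fromBlocks_zero₂₁ _ M.toBlocks₁₂, ← helim]
  simp

theorem schurNumerator_mem_of_row_mem {I : Ideal A} {M : Matrix (α ⊕ κ) (α ⊕ κ) A} {i : α}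
    (hrow : ∀ j, M (Sum.inl i) j ∈ I) (j : α) : schurNumerator M i j ∈ I := by
  rw [schurNumerator, Matrix.sub_apply, Matrix.smul_apply, smul_eq_mul, mul_apply]
  refine I.sub_mem (I.mul_mem_left _ (hrow _)) (I.sum_mem fun k _ => I.mul_mem_right _ ?_)
  rw [mul_apply]
  exact I.sum_mem fun l _ => I.mul_mem_right _ (hrow _)

theorem schurNumerator_mem_of_col_mem {I : Ideal A} {M : Matrix (α ⊕ κ) (α ⊕ κ) A} {j : α}
    (hcol : ∀ i, M i (Sum.inl j) ∈ I) (i : α) : schurNumerator M i j ∈ I := by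
  rw [schurNumerator, Matrix.sub_apply, Matrix.smul_apply, smul_eq_mul, mul_apply]
  exact I.sub_mem (I.mul_mem_left _ (hcol _)) (I.sum_mem fun k _ => I.mul_mem_left _ (hcol _))

theorem totalDegree_schurNumerator_le {σ R : Type*} [CommRing R]
    (M : Matrix (α ⊕ κ) (α ⊕ κ) (MvPolynomial σ R)) (hM : ∀ i j, (M i j).totalDegree ≤ 1)
    (i j : α) : (schurNumerator M i j).totalDegree ≤ Fintype.card κ + 1 := by
  have hblock (i j : κ) : (M.toBlocks₂₂ i j).totalDegree ≤ 1 := hM _ _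
  rw [schurNumerator, Matrix.sub_apply, Matrix.smul_apply, smul_eq_mul]
  refine (MvPolynomial.totalDegree_sub _ _).trans (max_le ?_ ?_)
  · have hdet := totalDegree_det_le M.toBlocks₂₂ (fun _ => 1) hblock
    exact (MvPolynomial.totalDegree_mul _ _).trans (add_le_add (by simpa using hdet) (hM _ _))
  · simp only [mul_apply]
    refine MvPolynomial.totalDegree_finsetSum_le fun k _ =>
      (MvPolynomial.totalDegree_mul _ _).trans (add_le_add ?_ (hM _ _))
    refine MvPolynomial.totalDegree_finsetSum_le fun l _ =>
      (MvPolynomial.totalDegree_mul _ _).trans ?_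
    have hadj := totalDegree_adjugate_le _ hblock l k
    have hentry : (M.toBlocks₁₂ i l).totalDegree ≤ 1 := hM _ _
    have hpos : 0 < Fintype.card κ := Fintype.card_pos_iff.2 ⟨k⟩
    omega

theorem derivation_det_sub_schurNumerator_mem {R : Type*} [CommRing R] [Algebra R A] [Fintype α]
    [DecidableEq α] (d : Derivation R A A) {q : Ideal A} [q.IsPrime]
    {M : Matrix (α ⊕ κ) (α ⊕ κ) A} {o : α} (hrow : ∀ j, schurNumerator M o j ∈ q)
    (hcol : ∀ i, schurNumerator M i o ∈ q) (hblock : M.toBlocks₂₂.det ∉ q) :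
    M.toBlocks₂₂.det ^ Fintype.card α * d M.det -
      M.toBlocks₂₂.det * (schurNumerator M).adjugate o o * d (schurNumerator M o o) ∈ q := by
  have hdetΦ : (schurNumerator M).det ∈ q := det_mem_of_row_mem hrow
  have hdetM : M.det ∈ q := by
    refine (‹q.IsPrime›.mem_or_mem ?_).resolve_right
      fun h => hblock (‹q.IsPrime›.mem_of_pow_mem (Fintype.card α) h)
    rw [← det_schurNumerator_mul]
    exact q.mul_mem_right _ hdetΦ
  have hder := congrArg d (det_schurNumerator_mul M)
  simp only [Derivation.leibniz, smul_eq_mul] at hder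
  have hentry := derivation_det_sub_mem d hrow hcol
  convert q.add_mem (q.mul_mem_left M.toBlocks₂₂.det hentry)
    (q.sub_mem (q.mul_mem_right (d M.toBlocks₂₂.det) hdetΦ)
      (q.mul_mem_right (d (M.toBlocks₂₂.det ^ Fintype.card α)) hdetM)) using 1
  linear_combination -hder

end Schur

section PowerSum

open MvPolynomial

theorem pderiv_sum_X_pow {σ R : Type*} [Fintype σ] [CommSemiring R] (d : ℕ) (i : σ) :
    pderiv i (∑ j, (X j : MvPolynomial σ R) ^ d) = C (d : R) * X i ^ (d - 1) := by
  rw [map_sum, Finset.sum_eq_single i]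
  · simp [Derivation.leibniz_pow]
  · intro j _ hj
    simp [Derivation.leibniz_pow, pderiv_X_of_ne hj]
  · simp

theorem le_totalDegree_sum_X_pow {σ R : Type*} [Fintype σ] [Nonempty σ] [CommSemiring R]
    [Nontrivial R] {d : ℕ} (hd : d ≠ 0) :
    d ≤ (∑ j, (X j : MvPolynomial σ R) ^ d).totalDegree := by
  classical
  obtain ⟨i⟩ := ‹Nonempty σ›
  have hcoeff : coeff (Finsupp.single i d) (∑ j, (X j : MvPolynomial σ R) ^ d) = 1 := by
    simp [coeff_sum, coeff_X_pow, Finsupp.single_left_inj hd]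
  simpa using le_totalDegree (mem_support_iff.2 (hcoeff.trans_ne one_ne_zero))

theorem HasDetRep.totalDegree_le {σ R : Type*} [CommRing R] {P : MvPolynomial σ R} {m : ℕ}
    (h : HasDetRep P m) : P.totalDegree ≤ m := by
  obtain ⟨M, hM, rfl⟩ := h
  simpa using totalDegree_det_le M (fun _ => 1) hM

theorem hasDetRep_detComplexity {σ R : Type*} [CommRing R] (P : MvPolynomial σ R) :
    HasDetRep P (detComplexity P) := by
  classical
  exact Nat.find_spec (exists_hasDetRep P)

variable {σ F : Type*} [Field F]

theorem HasDetRep.exists_map_constantCoeff_eq_diagonal {P : MvPolynomial σ F} {m : ℕ}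
    (h : HasDetRep P m) :
    ∃ (M : Matrix (Fin m) (Fin m) (MvPolynomial σ F)) (D : Fin m → F),
      (∀ i j, (M i j).totalDegree ≤ 1) ∧ M.det = P ∧
        M.map constantCoeff = Matrix.diagonal D := by
  obtain ⟨M, hM, rfl⟩ := h
  obtain ⟨L, L', D, hD⟩ :=
    Matrix.Pivot.exists_list_transvec_mul_mul_list_transvec_eq_diagonal (M.map constantCoeff)
  set G := (L.map Matrix.TransvectionStruct.toMatrix).prod
  set H := (L'.map Matrix.TransvectionStruct.toMatrix).prod
  have hconst (E : Matrix (Fin m) (Fin m) F) :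
      (E.map (C : F →+* MvPolynomial σ F)).map constantCoeff = E := by
    ext i j
    simp
  have hdet {E : Matrix (Fin m) (Fin m) F} (hE : E.det = 1) :
      (E.map (C : F →+* MvPolynomial σ F)).det = 1 := by
    rw [← RingHom.mapMatrix_apply, ← RingHom.map_det, hE, map_one]
  refine ⟨G.map C * M * H.map C, D, totalDegree_map_C_mul_mul_map_C_le G H hM, ?_, ?_⟩
  · rw [Matrix.det_mul, Matrix.det_mul, hdet (Matrix.TransvectionStruct.det_toMatrix_prod L),
      hdet (Matrix.TransvectionStruct.det_toMatrix_prod L'), one_mul, mul_one]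
  · rw [Matrix.map_mul, Matrix.map_mul, hconst, hconst, hD]

theorem exists_eq_zero_and_forall_ne_zero {ι : Type*} [Fintype ι] [DecidableEq ι] {D : ι → F}
    (hdet : (Matrix.diagonal D).det = 0) (hadj : (Matrix.diagonal D).adjugate ≠ 0) :
    ∃ o, D o = 0 ∧ ∀ i, i ≠ o → D i ≠ 0 := by
  rw [Matrix.det_diagonal, Finset.prod_eq_zero_iff] at hdet
  obtain ⟨o, -, ho⟩ := hdet
  refine ⟨o, ho, fun i hi hDi => hadj ?_⟩
  rw [Matrix.adjugate_diagonal, Matrix.diagonal_eq_zero]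
  funext j
  obtain rfl | hj := eq_or_ne j o
  · exact Finset.prod_eq_zero (Finset.mem_erase.2 ⟨hi, Finset.mem_univ i⟩) hDi
  · exact Finset.prod_eq_zero (Finset.mem_erase.2 ⟨hj.symm, Finset.mem_univ o⟩) ho

theorem exists_sub_C_mul_mem_idealOfVars {δ : MvPolynomial σ F} (hδ : δ ∉ idealOfVars σ F)
    (ψ : MvPolynomial σ F) : ∃ c, ψ - C c * δ ∈ idealOfVars σ F := by
  rw [mem_idealOfVars_iff] at hδ
  refine ⟨constantCoeff ψ / constantCoeff δ, mem_idealOfVars_iff.2 ?_⟩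
  rw [map_sub, map_mul, constantCoeff_C, div_mul_cancel₀ _ hδ, sub_self]

variable [Fintype σ] {d : ℕ}

theorem not_adjugateIdeal_le_idealOfVars {m : ℕ} (hd : (d : F) ≠ 0) (hσ : 4 < Fintype.card σ)
    {M : Matrix (Fin m) (Fin m) (MvPolynomial σ F)} (hdet : M.det = ∑ i, X i ^ d) :
    ¬ adjugateIdeal M ≤ idealOfVars σ F := by
  intro hle
  have hmin : idealOfVars σ F ∈ (adjugateIdeal M).minimalPrimes := by
    refine ⟨⟨isPrime_idealOfVars σ F, hle⟩, fun q ⟨hq, hMq⟩ _ => ?_⟩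
    rw [idealOfVars, Ideal.span_le, Set.range_subset_iff]
    intro i
    have hder : C (d : F) * X i ^ (d - 1) ∈ q := by
      rw [← pderiv_sum_X_pow, ← hdet]
      exact hMq (derivation_det_mem_adjugateIdeal _ _)
    exact hq.mem_of_pow_mem _
      ((Ideal.unit_mul_mem_iff_mem _ ((isUnit_iff_ne_zero.2 hd).map C)).1 hder)
  have hheight := (card_le_height_idealOfVars σ F).trans
    (height_le_four_of_mem_minimalPrimes_adjugateIdeal m M hmin)
  exact absurd hheight (not_le.2 (by exact_mod_cast hσ))

section Blocks

variable {α κ : Type*} [Fintype α] [DecidableEq α] [Fintype κ] [DecidableEq κ]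
  {M : Matrix (α ⊕ κ) (α ⊕ κ) (MvPolynomial σ F)} {o : α}

theorem eq_idealOfVars_of_schurNumerator_mem (hd : (d : F) ≠ 0) (hκ : Fintype.card κ + 2 ≤ d)
    (hM : ∀ i j, (M i j).totalDegree ≤ 1) (hdet : M.det = ∑ i, X i ^ d)
    {q : Ideal (MvPolynomial σ F)} [q.IsPrime] (hq : q ≤ idealOfVars σ F)
    (hrow : ∀ j, schurNumerator M o j ∈ q) (hcol : ∀ i, schurNumerator M i o ∈ q)
    (hblock : M.toBlocks₂₂.det ∉ idealOfVars σ F) {c : F}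
    (hc : M.toBlocks₂₂.det * (schurNumerator M).adjugate o o -
      C c * M.toBlocks₂₂.det ^ Fintype.card α ∈ q) : q = idealOfVars σ F := by
  have hprime := isPrime_idealOfVars σ F
  have hδ : M.toBlocks₂₂.det ^ Fintype.card α * C (d : F) ∉ idealOfVars σ F :=
    hprime.mul_notMem (fun h => hblock (hprime.mem_of_pow_mem _ h))
      (by simpa [mem_idealOfVars_iff] using hd)
  have hscale : C c * M.toBlocks₂₂.det ^ Fintype.card α =
      C (c / d) * (M.toBlocks₂₂.det ^ Fintype.card α * C (d : F)) := by
    rw [mul_left_comm, ← C_mul, div_mul_cancel₀ _ hd, mul_comm]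
  refine eq_idealOfVars_of_mul_X_pow_sub_mem (e := d - 1) hq hδ (hscale ▸ hc)
    (fun i => pderiv i (schurNumerator M o o)) (fun i => ?_) fun i => ?_
  · have hdeg := totalDegree_schurNumerator_le M hM o o
    have hder := totalDegree_pderiv_le i (schurNumerator M o o)
    omega
  · have hder := derivation_det_sub_schurNumerator_mem (pderiv i) hrow hcol fun h => hblock (hq h)
    rwa [hdet, pderiv_sum_X_pow, ← mul_assoc] at hder

theorem card_le_two_mul_card_of_det_eq_sum_X_pow (hd : (d : F) ≠ 0)
    (hκ : Fintype.card κ + 2 ≤ d) (hM : ∀ i j, (M i j).totalDegree ≤ 1)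
    (hdet : M.det = ∑ i, X i ^ d) (hrow : ∀ j, M (Sum.inl o) j ∈ idealOfVars σ F)
    (hcol : ∀ i, M i (Sum.inl o) ∈ idealOfVars σ F)
    (hblock : M.toBlocks₂₂.det ∉ idealOfVars σ F) :
    Fintype.card σ ≤ 2 * Fintype.card α := by
  have hprime := isPrime_idealOfVars σ F
  let Φ := schurNumerator M
  obtain ⟨c, hc⟩ := exists_sub_C_mul_mem_idealOfVars
    (fun h => hblock (hprime.mem_of_pow_mem (Fintype.card α) h))
    (M.toBlocks₂₂.det * Φ.adjugate o o)
  let ε := M.toBlocks₂₂.det * Φ.adjugate o o - C c * M.toBlocks₂₂.det ^ Fintype.card α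
  -- `Φ o o` lies both in the row and in the column of `o`, so its second copy can give way to `ε`.
  let g : α ⊕ α → MvPolynomial σ F := Sum.elim (Φ o) (Function.update (fun i => Φ i o) o ε)
  have hgo : g (Sum.inr o) = ε := Function.update_self ..
  have hgcol {i : α} (hi : i ≠ o) : g (Sum.inr i) = Φ i o := by
    simp only [g, Sum.elim_inr, Function.update_of_ne hi]
  have hg : Ideal.span (Set.range g) ≤ idealOfVars σ F := by
    rw [Ideal.span_le, Set.range_subset_iff]
    rintro (j | i)
    · exact schurNumerator_mem_of_row_mem hrow j
    · obtain rfl | hi := eq_or_ne i o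
      · exact hgo ▸ hc
      · exact hgcol hi ▸ schurNumerator_mem_of_col_mem hcol i
  have hmin : idealOfVars σ F ∈ (Ideal.span (Set.range g)).minimalPrimes := by
    refine ⟨⟨hprime, hg⟩, fun q ⟨hq, hgq⟩ hqm => ?_⟩
    have hmem (x : α ⊕ α) : g x ∈ q := hgq (Ideal.subset_span ⟨x, rfl⟩)
    have hΦcol (i : α) : Φ i o ∈ q := by
      obtain rfl | hi := eq_or_ne i o
      · exact hmem (Sum.inl i)
      · exact hgcol hi ▸ hmem (Sum.inr i)
    exact (eq_idealOfVars_of_schurNumerator_mem hd hκ hM hdet hqm (fun j => hmem (Sum.inl j))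
      hΦcol hblock (hgo ▸ hmem (Sum.inr o))).ge
  have hheight := (card_le_height_idealOfVars σ F).trans
    (height_le_card_of_mem_minimalPrimes_span_range g hmin)
  rw [Fintype.card_sum, ← two_mul] at hheight
  exact_mod_cast hheight

end Blocks

theorem HasDetRep.card_add_two_mul_le [Nonempty σ] (hd : 2 ≤ d) (hF : (d : F) ≠ 0) {m : ℕ}
    (h : HasDetRep (∑ i, (X i : MvPolynomial σ F) ^ d) m) :
    Fintype.card σ + 2 * d ≤ 2 * m + 4 := by
  have hdm : d ≤ m := (le_totalDegree_sum_X_pow (by omega)).trans h.totalDegree_le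
  obtain hσ | hσ := Nat.lt_or_ge 4 (Fintype.card σ)
  swap
  · omega
  obtain ⟨M, D, hM, hdet, hD⟩ := h.exists_map_constantCoeff_eq_diagonal
  have hentry (i j : Fin m) : constantCoeff (M i j) = Matrix.diagonal D i j := congrFun₂ hD i j
  obtain ⟨o, ho, hne⟩ : ∃ o, D o = 0 ∧ ∀ i, i ≠ o → D i ≠ 0 := by
    refine exists_eq_zero_and_forall_ne_zero ?_ fun hadj => ?_
    · rw [← hD, ← RingHom.mapMatrix_apply, ← RingHom.map_det, hdet]
      simp [show d ≠ 0 by omega]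
    · refine not_adjugateIdeal_le_idealOfVars hF hσ hdet (adjugateIdeal_le_iff.2 fun i j => ?_)
      rw [← hD, ← RingHom.mapMatrix_apply, ← RingHom.map_adjugate] at hadj
      exact mem_idealOfVars_iff.2 (congrFun₂ hadj i j)
  obtain ⟨e, he⟩ : ∃ e : Fin (m - d + 2) ⊕ Fin (d - 2) ≃ Fin m, e (Sum.inl 0) = o := by
    let e : Fin (m - d + 2) ⊕ Fin (d - 2) ≃ Fin m :=
      Fintype.equivOfCardEq (by simp only [Fintype.card_sum, Fintype.card_fin]; omega)
    exact ⟨e.trans (Equiv.swap (e (Sum.inl 0)) o), by simp⟩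
  have hcard := card_le_two_mul_card_of_det_eq_sum_X_pow (M := M.submatrix e e) (o := 0) hF
    (by simp only [Fintype.card_fin]; omega) (fun _ _ => hM _ _)
    (by rw [Matrix.det_submatrix_equiv_self, hdet])
    (fun j => by simp [mem_idealOfVars_iff, hentry, he, Matrix.diagonal_apply, ho])
    (fun i => by
      rw [mem_idealOfVars_iff, Matrix.submatrix_apply, hentry, he, Matrix.diagonal_apply]
      split_ifs with hi <;> simp [hi, ho])
    fun hblock => ?_
  · rw [Fintype.card_fin] at hcard
    omega
  · have hdiag : (M.submatrix e e).toBlocks₂₂.map constantCoeff =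
        Matrix.diagonal fun i => D (e (Sum.inr i)) := by
      ext i j
      simp [Matrix.toBlocks₂₂, hentry, Matrix.diagonal_apply]
    rw [mem_idealOfVars_iff, RingHom.map_det, RingHom.mapMatrix_apply, hdiag,
      Matrix.det_diagonal, Finset.prod_eq_zero_iff] at hblock
    obtain ⟨i, -, hi⟩ := hblock
    exact hne _ (fun h => by simp [← he] at h) hi

theorem theorem1_general [Nonempty σ] (hd : 2 ≤ d) (hF : (d : F) ≠ 0) :
    (Fintype.card σ : ℝ) / 2 + d - 2 ≤ detComplexity (∑ i, (X i : MvPolynomial σ F) ^ d) := by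
  have hle := (hasDetRep_detComplexity _).card_add_two_mul_le (σ := σ) hd hF
  rify at hle
  linarith

theorem sub_two_le_detComplexity_sum_X_pow {n : ℕ} (hn : 2 ≤ n) (hF : (n : F) ≠ 0) :
    (3 / 2 : ℝ) * n - 2 ≤ detComplexity (∑ i : Fin n, (X i : MvPolynomial (Fin n) F) ^ n) := by
  have : Nonempty (Fin n) := ⟨⟨0, by omega⟩⟩
  have hle := theorem1_general (σ := Fin n) hn hF
  rw [Fintype.card_fin] at hle
  linarith

end PowerSum

theorem theorem1 :
    (∀ n : ℕ, 6 ≤ n →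
      (3 / 2 : ℝ) * n - 3 ≤
        (detComplexity (∑ i : Fin n, (MvPolynomial.X i : MvPolynomial (Fin n) ℂ) ^ n) : ℝ)) ∧
    (∀ (F : Type*) [Field F] [IsAlgClosed F] (p : ℕ) [Fact p.Prime] [CharP F p] (n : ℕ),
      6 ≤ n → ¬ p ∣ n →
      (3 / 2 : ℝ) * n - 3 ≤
        (detComplexity (∑ i : Fin n, (MvPolynomial.X i : MvPolynomial (Fin n) F) ^ n) : ℝ)) := by
  refine ⟨fun n hn => ?_, fun F _ _ p _ _ n hn hpn => ?_⟩
  · exact (sub_le_sub_left (by norm_num) _).trans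
      (sub_two_le_detComplexity_sum_X_pow (by omega) (Nat.cast_ne_zero.2 (by omega)))
  · exact (sub_le_sub_left (by norm_num) _).trans
      (sub_two_le_detComplexity_sum_X_pow (by omega) (mt (CharP.cast_eq_zero_iff F p n).1 hpn))
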